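/- For a finite set $S\subset\mathbb{R}^2$ in general position (no three distinct points of $S$ are collinear), let $\mathrm{sc}(S)$ be the number of crossing-free straight-edge spanning (Hamiltonian) cycles of $S$, i.e. of cycles with vertex set $S$, drawn with straight segments as edges, such that two distinct edges meet only at a common endpoint. (i) Let $S$ be a finite planar point set and $p$ a point outside the convex hull of $S$ such that $S\cup\{p\}$ is in general position. Then $\mathrm{sc}(S)\le \mathrm{sc}(S\cup\{p\})$. (ii) Let $c>1$ be a constant such that $\mathrm{sc}(S)=O(c^{|S|})$ over all finite planar point sets $S$ in general position that have an even number of points and whose convex hull is a triangle. Then $\mathrm{sc}(S)=O(c^{|S|})$ over all finite planar point sets $S$ in general position. Here, for a family $\mathcal{A}$ of finite planar point sets, "$\mathrm{sc}(S)=O(c^{|S|})$ over $\mathcal{A}$" means that there is a constant $K$ with $\mathrm{sc}(S)\le K\,c^{|S|}$ for every $S\in\mathcal{A}$. -/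

import Mathlib

open Filter Asymptotics

/-- The Euclidean plane. -/
abbrev Plane : Type := EuclideanSpace ℝ (Fin 2)

/-- General position: no three distinct points of `S` are collinear. -/
def InGeneralPosition (S : Finset Plane) : Prop :=
  ∀ a ∈ S, ∀ b ∈ S, ∀ c ∈ S, a ≠ b → a ≠ c → b ≠ c → ¬ Collinear ℝ {a, b, c}

/-- The convex hull of `S` is a (nondegenerate, filled) triangle. -/
def HasTriangularHull (S : Finset Plane) : Prop :=
  ∃ T : Affine.Triangle ℝ Plane,
    convexHull ℝ (S : Set Plane) = convexHull ℝ (Set.range T.points)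

/-- A graph on the point set `S`, with each edge drawn as the straight segment between its
endpoints, is crossing-free: two distinct edges meet only at a common endpoint. -/
def IsCrossingFree {S : Finset Plane} (G : SimpleGraph S) : Prop :=
  ∀ a b c d : S, G.Adj a b → G.Adj c d → s(a, b) ≠ s(c, d) →
    ∀ x : Plane, x ∈ segment ℝ (a : Plane) (b : Plane) →
      x ∈ segment ℝ (c : Plane) (d : Plane) →
      (x = a ∨ x = b) ∧ (x = c ∨ x = d)

/-- The graph `G` is a Hamiltonian cycle on its vertex set: some closed walk in `G` is a
Hamiltonian cycle and uses every edge of `G`. -/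
def IsSpanningCycle {S : Finset Plane} (G : SimpleGraph S) : Prop :=
  ∃ (v : S) (p : G.Walk v v), p.IsHamiltonianCycle ∧ ∀ e ∈ G.edgeSet, e ∈ p.edges

/-- The set of crossing-free straight-edge spanning cycles of `S`. A cycle is identified with
its graph, so starting point and orientation are not recorded. -/
def spanningCycles (S : Finset Plane) : Set (SimpleGraph S) :=
  {G | IsSpanningCycle G ∧ IsCrossingFree G}

/-- The number `sc(S)` of crossing-free straight-edge spanning cycles of `S`. -/
noncomputable def sc (S : Finset Plane) : ℕ :=
  (spanningCycles S).ncard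

/-- There are only finitely many spanning cycles, so `sc` is the true cardinality. -/
theorem spanningCycles_finite (S : Finset Plane) : (spanningCycles S).Finite :=
  Set.toFinite _

/-- `sc(S) = O(c ^ |S|)` over all point sets `S` in the family `A`: there is one constant `K`
with `sc(S) ≤ K * c ^ |S|` for every `S ∈ A`. -/
def ScBigO (A : Set (Finset Plane)) (c : ℝ) : Prop :=
  (fun S : Finset Plane => (sc S : ℝ)) =O[𝓟 A] (fun S : Finset Plane => c ^ S.card)

/-- The asymptotic bound, unfolded. -/
theorem scBigO_iff (A : Set (Finset Plane)) {c : ℝ} (hc : 0 < c) :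
    ScBigO A c ↔ ∃ K : ℝ, ∀ S ∈ A, (sc S : ℝ) ≤ K * c ^ S.card := by
  simp only [ScBigO, isBigO_principal, norm_pow, Real.norm_eq_abs, Nat.abs_cast,
    abs_of_pos hc]

/-! For (i), some edge ab of a crossing-free cycle on S is met by the segments pa and pb only at its
ends, and neither segment is met by any other edge except there. Replacing ab by the path a, p, b
then gives a crossing-free cycle on S ∪ {p}. This map is injective: the neighbours of p reveal which
edge was removed.

To find ab, separate p from the hull by a line and use the projective coordinates (`bearing`, 1 /
`depth`), which send p to infinity. Edges become graphs of affine functions over intervals, larger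
values lie closer to p, and general position gives distinct points distinct bearings. A planar
argument (`exists_top_segment`) yields a graph that no other one exceeds; that edge is the visible
one (`exists_visible_edge`).

For (ii), three far points enclose S in a triangle, and one more point corrects the parity if
needed. Each is added outside the current hull, so by (i) the count does not drop. At most four
points are added, which costs a factor of at most c ^ 4. -/

/-! ### A topmost segment among non-crossing ones -/

/-- Among finitely many affine functions `t ↦ k i * t + h i` on intervals `[l i, r i]` whose graphs
meet only at endpoints, one is nowhere exceeded by another. -/
theorem exists_top_segment {ι : Type*} [Finite ι] [Nonempty ι] (l r k h : ι → ℝ)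
    (hleft : ∀ i j, l i = l j → k i * l i + h i = k j * l j + h j)
    (hcross : ∀ i j, ∀ t, l i ≤ t → t ≤ r i → l j ≤ t → t ≤ r j →
      k i * t + h i = k j * t + h j → i = j ∨ ((t = l i ∨ t = r i) ∧ (t = l j ∨ t = r j))) :
    ∃ i, ∀ j t, l i ≤ t → t ≤ r i → l j ≤ t → t ≤ r j → k j * t + h j ≤ k i * t + h i := by
  -- If the order of two graphs changes between s and t, they meet at some u in [s, t). As u lies
  -- before both right ends, it must be the left end of both.
  have key : ∀ i j s t, s < t → l i ≤ s → t ≤ r i → l j ≤ s → t ≤ r j →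
      k i * s + h i ≤ k j * s + h j → k j * t + h j < k i * t + h i →
      l i = s ∧ l j = s := by
    intro i j s t hst his hit hjs hjt h1 h2
    set A := k j * s + h j - (k i * s + h i) with hA
    set B := k i * t + h i - (k j * t + h j) with hB
    have hA0 : 0 ≤ A := by linarith
    have hB0 : 0 < B := by linarith
    have hAB : 0 < A + B := by linarith
    -- The zero of the affine difference, which goes from -A at s to B at t.
    set u := s + A / (A + B) * (t - s) with hu
    have hq0 : 0 ≤ A / (A + B) := by positivity
    have hq1 : A / (A + B) < 1 := by rw [div_lt_one hAB]; linarith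
    have hsu : s ≤ u := by nlinarith
    have hut : u < t := by nlinarith
    have heq : k i * u + h i = k j * u + h j := by
      have e : A / (A + B) * (A + B) = A := by field_simp
      have e2 : k i * u + h i - (k j * u + h j) = A / (A + B) * (A + B) - A := by
        rw [hu, hA, hB]; ring
      linarith
    rcases hcross i j u (by linarith) (by linarith) (by linarith) (by linarith) heq with
      hij | ⟨h3, h4⟩
    · subst hij; exact absurd h2 (lt_irrefl _)
    · constructor
      · rcases h3 with h3 | h3 <;> linarith
      · rcases h4 with h4 | h4 <;> linarith
  -- Segments whose left end is visible from above. The topmost one is found among them by taking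
  -- the rightmost left end and, for ties, the steepest slope.
  let V : Set ι := {i | ∀ j, l j ≤ l i → l i ≤ r j → k j * l i + h j ≤ k i * l i + h i}
  have hV : V.Nonempty := by
    obtain ⟨i, hi⟩ := Finite.exists_min l
    refine ⟨i, fun j h1 _ => ?_⟩
    have e := le_antisymm (hi j) h1
    have := hleft i j e
    rw [← e] at this
    exact this.ge
  obtain ⟨i, hiV, hi⟩ := V.toFinite.exists_maximalFor (fun i => toLex (l i, k i)) V hV
  refine ⟨i, ?_⟩
  by_contra! hbad
  let B : Set ι := {j | ∃ t, l i ≤ t ∧ t ≤ r i ∧ l j ≤ t ∧ t ≤ r j ∧ k i * t + h i < k j * t + h j}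
  -- Take a segment exceeding i whose left end is leftmost. If it starts before i, it would have to
  -- cross i. Otherwise its left end is visible too, and it beats i in the lexicographic order.
  obtain ⟨j, hjB, hj⟩ := B.toFinite.exists_minimalFor l B hbad
  obtain ⟨t, h1, h2, h3, h4, h5⟩ := hjB
  rcases lt_trichotomy (l j) (l i) with hlt | heq | hgt
  · have hv := hiV j hlt.le (h1.trans h4)
    rcases h1.eq_or_lt with e | hlt'
    · subst e; linarith
    · have := (key j i (l i) t hlt' hlt.le h4 le_rfl h2 hv h5).1
      linarith
  · have e := hleft j i heq
    have hlt : l i < t := by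
      rcases h1.eq_or_lt with e' | h'
      · subst e'; rw [heq] at e; linarith
      · exact h'
    have hk : k i < k j := by
      rw [heq] at e
      by_contra! hc
      nlinarith
    have hjV : j ∈ V := by
      intro m hm1 hm2
      have := hiV m (heq ▸ hm1) (heq ▸ hm2)
      rw [← heq] at this e
      linarith
    have : toLex (l i, k i) ≤ toLex (l j, k j) := by
      rw [Prod.Lex.le_iff]; right; exact ⟨heq.symm, hk.le⟩
    have := hi hjV this
    rw [Prod.Lex.le_iff] at this
    rcases this with h | h
    · exact absurd h (by simp [heq])
    · exact absurd h.2 (not_le.2 hk)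
  · have habove : k i * l j + h i ≤ k j * l j + h j := by
      by_contra! hc
      rcases h3.eq_or_lt with e' | h'
      · subst e'; linarith
      · have := (key j i (l j) t h' le_rfl h4 hgt.le h2 hc.le h5).2
        linarith
    have hjV : j ∈ V := by
      intro m hm1 hm2
      by_contra! hc
      -- A segment m hiding the left end of j also exceeds i there, so by minimality it starts at
      -- the same abscissa, hence at the same height.
      have hmB : m ∈ B := ⟨l j, hgt.le, h3.trans h2, hm1, hm2, by linarith⟩
      have e : l m = l j := le_antisymm hm1 (hj hmB hm1)
      have := hleft m j e
      rw [e] at this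
      linarith
    have : toLex (l i, k i) ≤ toLex (l j, k j) := by
      rw [Prod.Lex.le_iff]; left; exact hgt
    have := hi hjV this
    rw [Prod.Lex.le_iff] at this
    rcases this with h | h
    · exact absurd h (not_lt.2 hgt.le)
    · exact absurd h.1 hgt.ne'

/-! ### Orientation and separation from the hull -/

/-- Twice the signed area of the triangle `a b c`. -/
def signedArea (a b c : Plane) : ℝ := (b 0 - a 0) * (c 1 - a 1) - (b 1 - a 1) * (c 0 - a 0)

theorem collinear_iff_signedArea_eq_zero (a b c : Plane) :
    Collinear ℝ {a, b, c} ↔ signedArea a b c = 0 := by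
  rw [collinear_iff_of_mem (p₀ := a) (by simp)]
  constructor
  · rintro ⟨v, hv⟩
    obtain ⟨s, hs⟩ := hv b (by simp)
    obtain ⟨t, ht⟩ := hv c (by simp)
    subst hs ht
    simp [signedArea]; ring
  · intro h
    by_cases hab : a = b
    · subst hab
      refine ⟨c - a, ?_⟩
      simp only [Set.mem_insert_iff, Set.mem_singleton_iff, forall_eq_or_imp, forall_eq]
      exact ⟨⟨0, by simp⟩, ⟨0, by simp⟩, 1, by simp⟩
    · refine ⟨b - a, ?_⟩
      have hne : (b 0 - a 0) ^ 2 + (b 1 - a 1) ^ 2 ≠ 0 := by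
        intro h0
        apply hab
        ext i; fin_cases i <;> simp <;> nlinarith [sq_nonneg (b 0 - a 0), sq_nonneg (b 1 - a 1)]
      unfold signedArea at h
      -- The coefficient is that of the orthogonal projection of c - a onto b - a.
      have hc : c = (((c 0 - a 0) * (b 0 - a 0) + (c 1 - a 1) * (b 1 - a 1)) /
          ((b 0 - a 0) ^ 2 + (b 1 - a 1) ^ 2)) • (b - a) +ᵥ a := by
        ext i; fin_cases i
        · simp; field_simp; linear_combination (b 1 - a 1) * (-h)
        · simp; field_simp; linear_combination (b 0 - a 0) * h
      simp only [Set.mem_insert_iff, Set.mem_singleton_iff, forall_eq_or_imp, forall_eq]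
      exact ⟨⟨0, by simp⟩, ⟨1, by simp⟩, _, hc⟩

theorem InGeneralPosition.signedArea_ne_zero {S : Finset Plane} (hS : InGeneralPosition S)
    {a b c : Plane} (ha : a ∈ S) (hb : b ∈ S) (hc : c ∈ S) (hab : a ≠ b) (hac : a ≠ c)
    (hbc : b ≠ c) : signedArea a b c ≠ 0 := fun h =>
  hS a ha b hb c hc hab hac hbc ((collinear_iff_signedArea_eq_zero a b c).2 h)

theorem exists_pos_functional {S : Finset Plane} {p : Plane}
    (hp : p ∉ convexHull ℝ (S : Set Plane)) :
    ∃ α β : ℝ, ∀ s ∈ S, 0 < α * (s 0 - p 0) + β * (s 1 - p 1) := by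
  obtain ⟨f, u, hf, hu⟩ := geometric_hahn_banach_point_closed (convex_convexHull ℝ (S : Set Plane))
    (S.finite_toSet.isCompact_convexHull (𝕜 := ℝ)).isClosed hp
  have hfv : ∀ v : Plane, f v = f (EuclideanSpace.single 0 1) * v 0
      + f (EuclideanSpace.single 1 1) * v 1 := by
    intro v
    have : v = v 0 • EuclideanSpace.single (0 : Fin 2) (1 : ℝ)
        + v 1 • EuclideanSpace.single (1 : Fin 2) (1 : ℝ) := by
      ext i; fin_cases i <;> simp
    conv_lhs => rw [this]
    simp [mul_comm]
  refine ⟨f (EuclideanSpace.single 0 1), f (EuclideanSpace.single 1 1), fun s hs => ?_⟩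
  have h1 := hu s (subset_convexHull ℝ _ hs)
  rw [hfv s] at h1
  rw [hfv p] at hf
  linarith

/-! ### Projective coordinates that send p to infinity -/

section Projective

variable (α β : ℝ) (p : Plane)

/-- Depth of `x` as seen from `p` in direction `(α, β)`. -/
def depth (x : Plane) : ℝ := α * (x 0 - p 0) + β * (x 1 - p 1)

/-- Displacement of `x` orthogonal to the viewing direction `(α, β)` from `p`. -/
def offset (x : Plane) : ℝ := α * (x 1 - p 1) - β * (x 0 - p 0)

/-- Tangent of the angle under which `x` is seen from `p`. -/
noncomputable def bearing (x : Plane) : ℝ := offset α β p x / depth α β p x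

variable {α β p}

theorem eq_of_depth_eq_of_offset_eq (h0 : α ^ 2 + β ^ 2 ≠ 0) {x y : Plane}
    (h1 : depth α β p x = depth α β p y) (h2 : offset α β p x = offset α β p y) : x = y := by
  unfold depth at h1
  unfold offset at h2
  ext i; fin_cases i
  · apply mul_left_cancel₀ h0
    simp only [Fin.zero_eta]
    linear_combination α * h1 - β * h2
  · apply mul_left_cancel₀ h0
    simp only [Fin.mk_one]
    linear_combination β * h1 + α * h2

theorem depth_combo {s t : ℝ} (hst : s + t = 1) (x y : Plane) :
    depth α β p (s • x + t • y) = s * depth α β p x + t * depth α β p y := by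
  obtain rfl : t = 1 - s := by linarith
  simp [depth]; ring

theorem offset_combo {s t : ℝ} (hst : s + t = 1) (x y : Plane) :
    offset α β p (s • x + t • y) = s * offset α β p x + t * offset α β p y := by
  obtain rfl : t = 1 - s := by linarith
  simp [offset]; ring

/-- The determinant of the (depth, offset) vectors of a and b is α ^ 2 + β ^ 2 times the signed area
of p, a, b, so equal bearings would make these three points collinear. -/
theorem bearing_injOn {S : Finset Plane} (hS : InGeneralPosition (insert p S))
    (hd : ∀ s ∈ S, 0 < depth α β p s) : Set.InjOn (bearing α β p) S := by
  intro a ha b hb hab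
  by_contra hne
  have hda := hd a ha
  have hdb := hd b hb
  have hpa : p ≠ a := by rintro rfl; simp [depth] at hda
  have hpb : p ≠ b := by rintro rfl; simp [depth] at hdb
  apply hS.signedArea_ne_zero (Finset.mem_insert_self p S) (Finset.mem_insert_of_mem ha)
    (Finset.mem_insert_of_mem hb) hpa hpb hne
  have h0 : α ^ 2 + β ^ 2 ≠ 0 := by
    intro h
    have h1 : α = 0 := by nlinarith [sq_nonneg α, sq_nonneg β]
    have h2 : β = 0 := by nlinarith [sq_nonneg α, sq_nonneg β]
    simp [depth, h1, h2] at hda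
  unfold bearing at hab
  rw [div_eq_div_iff hda.ne' hdb.ne'] at hab
  apply mul_left_cancel₀ h0
  unfold depth offset at hab
  unfold signedArea
  linear_combination -hab

/-- A segment lies on a line `k * offset + h * depth = 1`, between the bearings of its ends. -/
theorem mem_segment_bearing {c d x : Plane} (hc : 0 < depth α β p c) (hd : 0 < depth α β p d)
    {k h : ℝ} (hcd : bearing α β p c ≤ bearing α β p d)
    (h1 : k * bearing α β p c + h = 1 / depth α β p c)
    (h2 : k * bearing α β p d + h = 1 / depth α β p d) (hx : x ∈ segment ℝ c d) :
    0 < depth α β p x ∧ bearing α β p c ≤ bearing α β p x ∧ bearing α β p x ≤ bearing α β p d ∧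
      (k * bearing α β p x + h) * depth α β p x = 1 := by
  obtain ⟨s, t, hs, ht, hst, rfl⟩ := hx
  have hpos : 0 < depth α β p (s • c + t • d) := by
    rw [depth_combo hst]
    rcases hs.eq_or_lt with h | h
    · subst h; simp at hst; subst hst; simpa
    · have : 0 < s * depth α β p c := by positivity
      have : 0 ≤ t * depth α β p d := by positivity
      linarith
  have ec : offset α β p c = bearing α β p c * depth α β p c := by
    unfold bearing; field_simp
  have ed : offset α β p d = bearing α β p d * depth α β p d := by
    unfold bearing; field_simp
  have hx : offset α β p (s • c + t • d) =
      bearing α β p (s • c + t • d) * depth α β p (s • c + t • d) := by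
    unfold bearing; field_simp
  rw [eq_div_iff hc.ne'] at h1
  rw [eq_div_iff hd.ne'] at h2
  have hs' : 0 ≤ s * depth α β p c := by positivity
  have ht' : 0 ≤ t * depth α β p d := by positivity
  refine ⟨hpos, ?_, ?_, ?_⟩
  · apply le_of_mul_le_mul_right _ hpos
    rw [← hx, offset_combo hst, depth_combo hst, ec, ed]
    nlinarith [mul_le_mul_of_nonneg_left hcd ht']
  · apply le_of_mul_le_mul_right _ hpos
    rw [← hx, offset_combo hst, depth_combo hst, ec, ed]
    nlinarith [mul_le_mul_of_nonneg_left hcd hs']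
  · rw [add_mul, mul_assoc, ← hx, offset_combo hst, depth_combo hst, ec, ed]
    linear_combination s * h1 + t * h2 + hst

theorem exists_mem_segment_bearing {c d : Plane} (hc : 0 < depth α β p c)
    (hd : 0 < depth α β p d) (hcd : bearing α β p c < bearing α β p d) {t : ℝ}
    (h1 : bearing α β p c ≤ t) (h2 : t ≤ bearing α β p d) :
    ∃ x ∈ segment ℝ c d, offset α β p x = t * depth α β p x := by
  -- The function offset - t * depth is affine along the segment, with value -v at c and u at d. It
  -- vanishes at the combination with weights proportional to u at c and v at d.
  set u := (bearing α β p d - t) * depth α β p d with hu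
  set v := (t - bearing α β p c) * depth α β p c with hv
  have hu0 : 0 ≤ u := mul_nonneg (by linarith) hd.le
  have hv0 : 0 ≤ v := mul_nonneg (by linarith) hc.le
  have huv : 0 < u + v := by
    rcases h1.eq_or_lt with h | h
    · have : 0 < u := mul_pos (by linarith) hd
      linarith
    · have : 0 < v := mul_pos (by linarith) hc
      linarith
  have hst : u / (u + v) + v / (u + v) = 1 := by field_simp
  refine ⟨(u / (u + v)) • c + (v / (u + v)) • d,
    ⟨_, _, by positivity, by positivity, hst, rfl⟩, ?_⟩
  rw [offset_combo hst, depth_combo hst]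
  have ec : offset α β p c = bearing α β p c * depth α β p c := by
    unfold bearing; field_simp
  have ed : offset α β p d = bearing α β p d * depth α β p d := by
    unfold bearing; field_simp
  rw [ec, ed]
  field_simp
  rw [hu, hv]
  ring

theorem eq_of_mem_segment_viewpoint {a x : Plane} (ha : 0 < depth α β p a)
    (hx : x ∈ segment ℝ p a) (hxd : 0 < depth α β p x) :
    bearing α β p x = bearing α β p a ∧ (depth α β p a ≤ depth α β p x → x = a) := by
  obtain ⟨s, t, hs, ht, hst, rfl⟩ := hx
  have hp : depth α β p p = 0 := by simp [depth]
  have hp' : offset α β p p = 0 := by simp [offset]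
  rw [depth_combo hst, hp] at hxd
  have ht0 : t ≠ 0 := by rintro rfl; simp at hxd
  constructor
  · unfold bearing
    rw [offset_combo hst, depth_combo hst, hp, hp']
    field_simp
    ring
  · intro h
    rw [depth_combo hst, hp] at h
    have : t = 1 := by nlinarith
    subst this
    obtain rfl : s = 0 := by linarith
    simp

end Projective

/-! ### Existence of a visible edge -/

/-- Every crossing-free graph has an edge that is completely visible from a point outside the
convex hull. -/
theorem exists_visible_edge {S : Finset Plane} {p : Plane} (hS : InGeneralPosition (insert p S))
    (hp : p ∉ convexHull ℝ (S : Set Plane)) (G : SimpleGraph S) (hG : IsCrossingFree G)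
    (hne : ∃ a b, G.Adj a b) :
    ∃ a b, G.Adj a b ∧ ∀ c d, G.Adj c d → ∀ x ∈ segment ℝ (c : Plane) (d : Plane),
      (x ∈ segment ℝ p a → x = a) ∧ (x ∈ segment ℝ p b → x = b) := by
  obtain ⟨α, β, hd⟩ := exists_pos_functional hp
  change ∀ s ∈ S, 0 < depth α β p s at hd
  have hinj := bearing_injOn hS hd
  have hinj' : ∀ a b : S, bearing α β p a = bearing α β p b → a = b := fun a b h =>
    Subtype.ext (hinj a.2 b.2 h)
  -- Each edge is listed once, oriented by increasing bearing; `k` and `h` below are the slope and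
  -- intercept of its image in the coordinates (bearing, 1 / depth).
  let ι := {e : S × S // G.Adj e.1 e.2 ∧ bearing α β p e.1 < bearing α β p e.2}
  have orient : ∀ a b, G.Adj a b → bearing α β p a < bearing α β p b ∨
      bearing α β p b < bearing α β p a := by
    intro a b h
    rcases lt_trichotomy (bearing α β p a) (bearing α β p b) with h1 | h1 | h1
    · exact Or.inl h1
    · exact absurd (hinj' a b h1) h.ne
    · exact Or.inr h1
  have : Nonempty ι := by
    obtain ⟨a, b, h⟩ := hne
    rcases orient a b h with h1 | h1
    · exact ⟨⟨(a, b), h, h1⟩⟩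
    · exact ⟨⟨(b, a), h.symm, h1⟩⟩
  have h0 : α ^ 2 + β ^ 2 ≠ 0 := by
    obtain ⟨a, b, h⟩ := hne
    intro h
    have h1 : α = 0 := by nlinarith [sq_nonneg α, sq_nonneg β]
    have h2 : β = 0 := by nlinarith [sq_nonneg α, sq_nonneg β]
    have := hd a a.2
    simp [depth, h1, h2] at this
  let l : ι → ℝ := fun e => bearing α β p e.1.1
  let r : ι → ℝ := fun e => bearing α β p e.1.2
  let k : ι → ℝ := fun e =>
    (1 / depth α β p e.1.2 - 1 / depth α β p e.1.1) / (r e - l e)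
  let h : ι → ℝ := fun e => 1 / depth α β p e.1.1 - k e * l e
  have hlr : ∀ e, l e < r e := fun e => e.2.2
  have hl : ∀ e, k e * l e + h e = 1 / depth α β p e.1.1 := fun e => by simp only [h]; ring
  have hr : ∀ e, k e * r e + h e = 1 / depth α β p e.1.2 := by
    intro e
    have : r e - l e ≠ 0 := (sub_pos.2 (hlr e)).ne'
    have h3 : k e * (r e - l e) = 1 / depth α β p e.1.2 - 1 / depth α β p e.1.1 := by
      simp only [k]; field_simp
    simp only [h]; linear_combination h3
  have hseg : ∀ e : ι, ∀ x ∈ segment ℝ (e.1.1 : Plane) (e.1.2 : Plane),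
      0 < depth α β p x ∧ l e ≤ bearing α β p x ∧ bearing α β p x ≤ r e ∧
      (k e * bearing α β p x + h e) * depth α β p x = 1 := fun e x hx =>
    mem_segment_bearing (hd _ e.1.1.2) (hd _ e.1.2.2) (hlr e).le (hl e) (hr e) hx
  obtain ⟨e, he⟩ := exists_top_segment l r k h
    (by
      intro i j hij
      rw [hl, hl, hinj' _ _ hij])
    (by
      intro i j t h1 h2 h3 h4 h5
      by_cases hij : i = j
      · exact Or.inl hij
      right
      -- A meeting point of two graphs lifts to a common point of the two edges, since bearing and
      -- depth determine a point; crossing-freeness then applies.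
      obtain ⟨x, hx, hxt⟩ := exists_mem_segment_bearing (hd _ i.1.1.2) (hd _ i.1.2.2) (hlr i) h1 h2
      obtain ⟨y, hy, hyt⟩ := exists_mem_segment_bearing (hd _ j.1.1.2) (hd _ j.1.2.2) (hlr j) h3 h4
      obtain ⟨hx0, -, -, hx1⟩ := hseg i x hx
      obtain ⟨hy0, -, -, hy1⟩ := hseg j y hy
      have hbx : bearing α β p x = t := by unfold bearing; rw [hxt]; field_simp
      have hby : bearing α β p y = t := by unfold bearing; rw [hyt]; field_simp
      rw [hbx] at hx1
      rw [hby, ← h5] at hy1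
      have hdep : depth α β p x = depth α β p y := by
        have hF : k i * t + h i ≠ 0 := by rintro h; simp [h] at hx1
        exact mul_left_cancel₀ hF (hx1.trans hy1.symm)
      obtain rfl : x = y := eq_of_depth_eq_of_offset_eq h0 hdep (by rw [hxt, hyt, hdep])
      have hne' : s(i.1.1, i.1.2) ≠ s(j.1.1, j.1.2) := by
        intro hs
        rw [Sym2.eq_iff] at hs
        rcases hs with ⟨e1, e2⟩ | ⟨e1, e2⟩
        · exact hij (Subtype.ext (Prod.ext e1 e2))
        · have := i.2.2
          rw [e1, e2] at this
          exact lt_asymm this j.2.2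
      have := hG _ _ _ _ i.2.1 j.2.1 hne' x hx hy
      rw [← hbx]
      refine ⟨this.1.imp ?_ ?_, this.2.imp ?_ ?_⟩ <;> exact fun h => congrArg (bearing α β p) h)
  refine ⟨e.1.1, e.1.2, e.2.1, ?_⟩
  -- A point x of an edge on the segment from p to an end of e has the bearing of that end. Since e
  -- is on top, x is at least as deep as that end, so the two coincide.
  have main : ∀ f : ι, ∀ x ∈ segment ℝ (f.1.1 : Plane) (f.1.2 : Plane),
      (x ∈ segment ℝ p e.1.1 → x = e.1.1) ∧ (x ∈ segment ℝ p e.1.2 → x = e.1.2) := by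
    intro f x hx
    obtain ⟨h1, h2, h3, h4⟩ := hseg f x hx
    constructor
    · intro hxp
      have hda := hd _ e.1.1.2
      obtain ⟨hb, himp⟩ := eq_of_mem_segment_viewpoint hda hxp h1
      apply himp
      rw [hb] at h2 h3 h4
      have := he f _ le_rfl (hlr e).le h2 h3
      rw [hl] at this
      have h5 := mul_le_mul_of_nonneg_right this h1.le
      simp only [l] at h5
      rw [h4, div_mul_eq_mul_div, one_mul, le_div_iff₀ hda] at h5
      linarith
    · intro hxp
      have hda := hd _ e.1.2.2
      obtain ⟨hb, himp⟩ := eq_of_mem_segment_viewpoint hda hxp h1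
      apply himp
      rw [hb] at h2 h3 h4
      have := he f _ (hlr e).le le_rfl h2 h3
      rw [hr] at this
      have h5 := mul_le_mul_of_nonneg_right this h1.le
      simp only [r] at h5
      rw [h4, div_mul_eq_mul_div, one_mul, le_div_iff₀ hda] at h5
      linarith
  intro c d hcd x hx
  rcases orient c d hcd with h1 | h1
  · exact main ⟨(c, d), hcd, h1⟩ x hx
  · exact main ⟨(d, c), hcd.symm, h1⟩ x (by rwa [segment_symm])

/-! ### Inserting a vertex into a Hamiltonian cycle -/

namespace SimpleGraph

variable {V W : Type*} {G : SimpleGraph V}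

theorem Walk.IsPath.fst_ne_of_mem_darts {u v : V} {q : G.Walk u v} (hq : q.IsPath) {d : G.Dart}
    (hd : d ∈ q.darts) : d.fst ≠ v := by
  induction q with
  | nil => simp at hd
  | cons h q ih =>
    rw [Walk.cons_isPath_iff] at hq
    rw [Walk.darts_cons, List.mem_cons] at hd
    rcases hd with rfl | hd
    · rintro rfl
      exact hq.2 q.end_mem_support
    · exact ih hq.1 hd

/-- A Hamiltonian cycle through the edge `ab` consists of `ab` and a Hamiltonian path. -/
theorem Walk.IsHamiltonianCycle.exists_path [DecidableEq V] {v a b : V} {c : G.Walk v v}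
    (hc : c.IsHamiltonianCycle) (hab : s(a, b) ∈ c.edges) :
    ∃ q : G.Walk b a, q.IsPath ∧ (∀ w, w ∈ q.support) ∧ s(a, b) ∉ q.edges ∧
      ∀ e ∈ c.edges, e = s(a, b) ∨ e ∈ q.edges := by
  have main : ∀ c : G.Walk v v, c.IsHamiltonianCycle → ∀ d ∈ c.darts, d.fst = a → d.snd = b →
      ∃ q : G.Walk b a, q.IsPath ∧ (∀ w, w ∈ q.support) ∧ s(a, b) ∉ q.edges ∧
        ∀ e ∈ c.edges, e = s(a, b) ∨ e ∈ q.edges := by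
    intro c hc d hd hda hdb
    -- Rotate the cycle to start at a. Its tail is a path ending at a, which never leaves a, so the
    -- dart from a to b must be the first one.
    have ha := hc.mem_support a
    have hc' := hc.rotate ha
    have hd' : d ∈ (c.rotate a ha).darts := (c.rotate_darts a ha).perm.mem_iff.2 hd
    have hE : ∀ e ∈ c.edges, e ∈ (c.rotate a ha).edges := fun e he =>
      (c.rotate_edges a ha).perm.mem_iff.2 he
    generalize c.rotate a ha = c' at hc' hd' hE
    cases c' with
    | nil => simp at hd'
    | cons h q =>
      have hcyc := (Walk.cons_isCycle_iff _ _).1 hc'.isCycle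
      rw [Walk.darts_cons, List.mem_cons] at hd'
      rcases hd' with rfl | hd'
      · change _ = b at hdb
        simp only at hdb
        subst hdb
        refine ⟨q, hcyc.1, fun w => ?_, hcyc.2, fun e he => ?_⟩
        · have := hc'.mem_support w
          rw [Walk.support_cons, List.mem_cons] at this
          rcases this with rfl | h
          · exact q.end_mem_support
          · exact h
        · simpa using hE e he
      · exact absurd hda (hcyc.1.fst_ne_of_mem_darts hd')
  obtain ⟨d, hd, hde⟩ := List.mem_map.1 hab
  change s(d.fst, d.snd) = s(a, b) at hde
  rw [Sym2.eq_iff] at hde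
  rcases hde with ⟨h1, h2⟩ | ⟨h1, h2⟩
  · exact main c hc d hd h1 h2
  -- The cycle runs through the edge from b to a; reverse it.
  · have hfin : Finite V := hc.finite
    have := Fintype.ofFinite V
    have hr : c.reverse.IsHamiltonianCycle := by
      rw [Walk.isHamiltonianCycle_iff_isCycle_and_length_eq] at hc ⊢
      simpa using hc
    have := main c.reverse hr d.symm (by simpa using hd) h2 h1
    simpa using this

/-- The graph obtained by replacing the edge `ab` with a path `a - p - b` through a new vertex. -/
def insertVertex (G : SimpleGraph V) (f : V ↪ W) (p : W) (a b : V) : SimpleGraph W :=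
  (G.deleteEdges {s(a, b)}).map f ⊔ edge p (f a) ⊔ edge p (f b)

variable {f : V ↪ W} {p : W} {a b : V}

theorem insertVertex_adj_image (hp : ∀ v, f v ≠ p) {x y : V} :
    (G.insertVertex f p a b).Adj (f x) (f y) ↔ G.Adj x y ∧ s(x, y) ≠ s(a, b) := by
  simp [insertVertex, edge_adj, hp]

theorem insertVertex_adj_new (hp : ∀ v, f v ≠ p) {x : V} :
    (G.insertVertex f p a b).Adj p (f x) ↔ x = a ∨ x = b := by
  have := fun v => (hp v).symm
  simp [insertVertex, edge_adj, hp, this]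

/-- The right-hand side uses a and b only through the new graph, so G is recovered from that graph
alone: the removed edge joins the two neighbours of p. This gives the injectivity behind (i). -/
theorem adj_iff_insertVertex_adj (hp : ∀ v, f v ≠ p) (hab : G.Adj a b) {x y : V} :
    G.Adj x y ↔ (G.insertVertex f p a b).Adj (f x) (f y) ∨
      (x ≠ y ∧ (G.insertVertex f p a b).Adj p (f x) ∧ (G.insertVertex f p a b).Adj p (f y)) := by
  rw [insertVertex_adj_image hp, insertVertex_adj_new hp, insertVertex_adj_new hp, ne_eq,
    Sym2.eq_iff]
  constructor
  · intro h
    have := h.ne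
    tauto
  · rintro (h | ⟨h, rfl | rfl, rfl | rfl⟩)
    · exact h.1
    · exact absurd rfl h
    · exact hab
    · exact hab.symm
    · exact absurd rfl h

theorem exists_isHamiltonianCycle_insertVertex [DecidableEq V] [DecidableEq W]
    (hp : ∀ v, f v ≠ p) (hW : ∀ w, w = p ∨ ∃ v, f v = w) (hab : G.Adj a b)
    {v : V} {c : G.Walk v v} (hc : c.IsHamiltonianCycle) (hcov : ∀ e ∈ G.edgeSet, e ∈ c.edges) :
    ∃ (w : W) (c' : (G.insertVertex f p a b).Walk w w), c'.IsHamiltonianCycle ∧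
      ∀ e ∈ (G.insertVertex f p a b).edgeSet, e ∈ c'.edges := by
  obtain ⟨q, hq, hqs, hqe, hcq⟩ := hc.exists_path (hcov s(a, b) hab)
  have hedge : ∀ e ∈ q.edges, e ∈ (G.deleteEdges {s(a, b)}).edgeSet := by
    intro e he
    rw [edgeSet_deleteEdges]
    exact ⟨q.edges_subset_edgeSet he, fun h => hqe (h ▸ he)⟩
  let φ : G.deleteEdges {s(a, b)} →g G.insertVertex f p a b :=
    ⟨f, fun {x y} h => (insertVertex_adj_image hp).2 (by simpa using h)⟩
  have hφ : ⇑φ = f := rfl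
  let q' : (G.insertVertex f p a b).Walk (f b) (f a) := (q.transfer _ hedge).map φ
  have hs : q'.support = q.support.map f := by simp [q', hφ]
  have he : q'.edges = q.edges.map (Sym2.map f) := by simp [q', hφ]
  have hq' : q'.IsPath := Walk.IsPath.map (f := φ) f.injective (hq.transfer hedge)
  have hap : (G.insertVertex f p a b).Adj (f a) p := ((insertVertex_adj_new hp).2 (Or.inl rfl)).symm
  have hpb : (G.insertVertex f p a b).Adj p (f b) := (insertVertex_adj_new hp).2 (Or.inr rfl)
  have hps : p ∉ q'.support := by
    rw [hs]
    simp [hp]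
  have hpath : (Walk.cons hpb q').IsPath := (Walk.cons_isPath_iff _ _).2 ⟨hq', hps⟩
  refine ⟨f a, Walk.cons hap (Walk.cons hpb q'), ⟨?_, ?_⟩, ?_⟩
  · rw [Walk.cons_isCycle_iff]
    refine ⟨hpath, fun h => ?_⟩
    rw [Walk.edges_cons, List.mem_cons] at h
    rcases h with h | h
    · rw [Sym2.eq_iff] at h
      rcases h with ⟨h, -⟩ | ⟨h, -⟩
      · exact hp a h
      · exact hab.ne (f.injective h)
    · exact hps (q'.snd_mem_support_of_mem_edges h)
  · have hall : ∀ w, w ∈ (Walk.cons hpb q').support := by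
      intro w
      rw [Walk.support_cons, List.mem_cons, hs, List.mem_map]
      exact (hW w).imp_right fun ⟨v, hv⟩ => ⟨v, hqs v, hv⟩
    have := hpath.isHamiltonian_of_mem hall
    simpa [Walk.tail_cons, Walk.IsHamiltonian] using this
  · intro e hmem
    rw [Walk.edges_cons, Walk.edges_cons, he]
    induction e using Sym2.ind with
    | _ x y =>
    rw [mem_edgeSet] at hmem
    have hnew : ∀ v, (G.insertVertex f p a b).Adj p (f v) →
        s(p, f v) ∈ s(f a, p) :: s(p, f b) :: q.edges.map (Sym2.map f) := by
      intro v hv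
      rcases (insertVertex_adj_new hp).1 hv with rfl | rfl
      · simp [Sym2.eq_swap]
      · simp
    rcases hW x with rfl | ⟨x, rfl⟩ <;> rcases hW y with rfl | ⟨y, rfl⟩
    · exact absurd hmem (SimpleGraph.irrefl _)
    · exact hnew y hmem
    · simpa [Sym2.eq_swap] using hnew x hmem.symm
    · rw [insertVertex_adj_image hp] at hmem
      have := (hcq _ (hcov s(x, y) hmem.1)).resolve_left hmem.2
      exact List.mem_cons_of_mem _ (List.mem_cons_of_mem _ (List.mem_map.2 ⟨_, this, rfl⟩))

end SimpleGraph

/-! ### Crossing-freeness after insertion, and part (i) -/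

theorem notMem_of_notMem_convexHull {S : Finset Plane} {p : Plane}
    (hp : p ∉ convexHull ℝ (S : Set Plane)) : p ∉ S := fun h => hp (subset_convexHull ℝ _ h)

/-- The inclusion of a point set into the point set with one point added. -/
def inclInsert (S : Finset Plane) (p : Plane) : S ↪ (insert p S : Finset Plane) :=
  ⟨fun x => ⟨x, Finset.mem_insert_of_mem x.2⟩, fun x y h => Subtype.ext (by simpa using h)⟩

/-- Two segments meet only at common endpoints. -/
def MeetAtEnds (a b c d : Plane) : Prop :=
  ∀ x, x ∈ segment ℝ a b → x ∈ segment ℝ c d → (x = a ∨ x = b) ∧ (x = c ∨ x = d)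

theorem MeetAtEnds.swap {a b c d : Plane} (h : MeetAtEnds a b c d) : MeetAtEnds c d a b :=
  fun x h1 h2 => (h x h2 h1).symm

theorem MeetAtEnds.flip {a b c d : Plane} (h : MeetAtEnds a b c d) : MeetAtEnds b a c d :=
  fun x h1 h2 => (h x (by rwa [segment_symm]) h2).imp_left Or.symm

theorem signedArea_eq_zero_of_mem_segment {a c d : Plane} (h : a ∈ segment ℝ c d) :
    signedArea a c d = 0 := by
  obtain ⟨s, t, -, -, hst, rfl⟩ := h
  obtain rfl : s = 1 - t := by linarith
  simp [signedArea]; ring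

theorem InGeneralPosition.eq_or_eq_of_mem_segment {S : Finset Plane} (hS : InGeneralPosition S)
    {a c d : Plane} (ha : a ∈ S) (hc : c ∈ S) (hd : d ∈ S) (hcd : c ≠ d)
    (h : a ∈ segment ℝ c d) : a = c ∨ a = d := by
  by_contra! hne
  exact hS.signedArea_ne_zero ha hc hd hne.1 hne.2 hcd (signedArea_eq_zero_of_mem_segment h)

theorem meetAtEnds_of_signedArea_ne_zero {p a b : Plane} (h : signedArea p a b ≠ 0) :
    MeetAtEnds p a p b := by
  rintro x ⟨s, t, -, -, hst, rfl⟩ ⟨s', t', -, -, hst', e⟩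
  obtain rfl : s = 1 - t := by linarith
  obtain rfl : s' = 1 - t' := by linarith
  have e0 := congrArg (fun v : Plane => v 0) e
  have e1 := congrArg (fun v : Plane => v 1) e
  simp only [PiLp.add_apply, PiLp.smul_apply, smul_eq_mul] at e0 e1
  have : t * signedArea p a b = 0 := by
    unfold signedArea
    linear_combination (b 0 - p 0) * e1 - (b 1 - p 1) * e0
  rcases mul_eq_zero.1 this with rfl | h'
  · simp
  · exact absurd h' h

/-- Visibility lets a new edge meet an old one only at a or b, and general position forces that
point to be an end of the old edge. The two new edges leave p in non-parallel directions. -/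
theorem isCrossingFree_insertVertex {S : Finset Plane} {p : Plane}
    (hS : InGeneralPosition (insert p S)) (hp : p ∉ S) {G : SimpleGraph S} (hG : IsCrossingFree G)
    {a b : S} (hab : G.Adj a b)
    (hvis : ∀ c d, G.Adj c d → ∀ x ∈ segment ℝ (c : Plane) (d : Plane),
      (x ∈ segment ℝ p a → x = a) ∧ (x ∈ segment ℝ p b → x = b)) :
    IsCrossingFree (G.insertVertex (inclInsert S p) ⟨p, Finset.mem_insert_self p S⟩ a b) := by
  set P : (insert p S : Finset Plane) := ⟨p, Finset.mem_insert_self p S⟩ with hP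
  have hf : ∀ v, inclInsert S p v ≠ P := by
    intro v h
    have h' : (v : Plane) = p := congrArg Subtype.val h
    exact hp (h' ▸ v.2)
  have hval : ∀ v, (inclInsert S p v : Plane) = v := fun _ => rfl
  have hW : ∀ w, w = P ∨ ∃ v, inclInsert S p v = w := by
    rintro ⟨w, hw⟩
    rcases Finset.mem_insert.1 hw with rfl | h
    · exact Or.inl rfl
    · exact Or.inr ⟨⟨w, h⟩, rfl⟩
  have mem : ∀ v : S, (v : Plane) ∈ insert p S := fun v => Finset.mem_insert_of_mem v.2
  have hne : ∀ v : S, p ≠ v := fun v h => hp (h ▸ v.2)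
  have hval_ne : ∀ {u v : S}, u ≠ v → (u : Plane) ≠ v := fun h h' => h (Subtype.ext h')
  have key : ∀ u : S, u = a ∨ u = b → ∀ c d : S, G.Adj c d → MeetAtEnds p u c d := by
    intro u hu c d hcd x hx1 hx2
    have hxu : x = u := by
      rcases hu with rfl | rfl
      · exact (hvis c d hcd x hx2).1 hx1
      · exact (hvis c d hcd x hx2).2 hx1
    subst hxu
    exact ⟨Or.inr rfl, hS.eq_or_eq_of_mem_segment (mem u) (mem c) (mem d) (hval_ne hcd.ne) hx2⟩
  have key2 : ∀ u v : S, u ≠ v → MeetAtEnds p u p v := fun u v huv =>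
    meetAtEnds_of_signedArea_ne_zero (hS.signedArea_ne_zero (Finset.mem_insert_self p S)
      (mem u) (mem v) (hne u) (hne v) (hval_ne huv))
  set H := G.insertVertex (inclInsert S p) P a b
  have cases : ∀ x y, H.Adj x y → (∃ u v, inclInsert S p u = x ∧ inclInsert S p v = y ∧ G.Adj u v) ∨
      (∃ u, (u = a ∨ u = b) ∧ (x = P ∧ inclInsert S p u = y ∨ y = P ∧ inclInsert S p u = x)) := by
    intro x y hxy
    rcases hW x with rfl | ⟨x, rfl⟩ <;> rcases hW y with rfl | ⟨y, rfl⟩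
    · exact absurd hxy (SimpleGraph.irrefl _)
    · exact Or.inr ⟨y, (SimpleGraph.insertVertex_adj_new hf).1 hxy, Or.inl ⟨rfl, rfl⟩⟩
    · exact Or.inr ⟨x, (SimpleGraph.insertVertex_adj_new hf).1 hxy.symm, Or.inr ⟨rfl, rfl⟩⟩
    · exact Or.inl ⟨x, y, rfl, rfl, ((SimpleGraph.insertVertex_adj_image hf).1 hxy).1⟩
  intro x y z w hxy hzw hdist
  change MeetAtEnds x y z w
  rcases cases x y hxy with ⟨u, v, rfl, rfl, huv⟩ | ⟨u, hu, h1⟩ <;>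
    rcases cases z w hzw with ⟨u', v', rfl, rfl, huv'⟩ | ⟨u', hu', h2⟩
  · refine hG u v u' v' huv huv' fun h => hdist ?_
    simpa using congrArg (Sym2.map (inclInsert S p)) h
  · have := (key u' hu' u v huv)
    rcases h2 with ⟨rfl, rfl⟩ | ⟨rfl, rfl⟩
    · exact this.swap
    · exact this.flip.swap
  · have := (key u hu u' v' huv')
    rcases h1 with ⟨rfl, rfl⟩ | ⟨rfl, rfl⟩
    · exact this
    · exact this.flip
  · have huu : u ≠ u' := by
      rintro rfl
      apply hdist
      rcases h1 with ⟨rfl, rfl⟩ | ⟨rfl, rfl⟩ <;> rcases h2 with ⟨rfl, rfl⟩ | ⟨rfl, rfl⟩ <;>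
        simp [Sym2.eq_swap]
    have := key2 u u' huu
    rcases h1 with ⟨rfl, rfl⟩ | ⟨rfl, rfl⟩ <;> rcases h2 with ⟨rfl, rfl⟩ | ⟨rfl, rfl⟩
    · exact this
    · exact this.swap.flip.swap
    · exact this.flip
    · exact this.flip.swap.flip.swap

/-- Adding a point outside the convex hull does not decrease the number of crossing-free
spanning cycles. -/
theorem sc_le_sc_insert {S : Finset Plane} {p : Plane} (hS : InGeneralPosition (insert p S))
    (hp : p ∉ convexHull ℝ (S : Set Plane)) : sc S ≤ sc (insert p S) := by
  classical
  have hpS := notMem_of_notMem_convexHull hp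
  set P : (insert p S : Finset Plane) := ⟨p, Finset.mem_insert_self p S⟩ with hP
  have hf : ∀ v, inclInsert S p v ≠ P := by
    intro v h
    have h' : (v : Plane) = p := congrArg Subtype.val h
    exact hpS (h' ▸ v.2)
  have hW : ∀ w, w = P ∨ ∃ v, inclInsert S p v = w := by
    rintro ⟨w, hw⟩
    rcases Finset.mem_insert.1 hw with rfl | h
    · exact Or.inl rfl
    · exact Or.inr ⟨⟨w, h⟩, rfl⟩
  have hex : ∀ G ∈ spanningCycles S, ∃ e : S × S, G.Adj e.1 e.2 ∧
      G.insertVertex (inclInsert S p) P e.1 e.2 ∈ spanningCycles (insert p S) := by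
    rintro G ⟨⟨v, c, hc, hcov⟩, hG⟩
    have hadj : ∃ a b, G.Adj a b := by
      cases c with
      | nil => exact absurd hc.isCycle (by simp)
      | cons h _ => exact ⟨_, _, h⟩
    obtain ⟨a, b, hab, hvis⟩ := exists_visible_edge hS hp G hG hadj
    exact ⟨(a, b), hab, SimpleGraph.exists_isHamiltonianCycle_insertVertex hf hW hab hc hcov,
      isCrossingFree_insertVertex hS hpS hG hab hvis⟩
  choose e he using hex
  have := (spanningCycles_finite (insert p S)).to_subtype
  refine Nat.card_le_card_of_injective
    (fun G : spanningCycles S => (⟨_, (he G.1 G.2).2⟩ : spanningCycles (insert p S))) ?_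
  rintro ⟨G, hG⟩ ⟨G', hG'⟩ heq
  simp only [Subtype.mk.injEq] at heq
  ext x y
  rw [SimpleGraph.adj_iff_insertVertex_adj hf (he G hG).1,
    SimpleGraph.adj_iff_insertVertex_adj hf (he G' hG').1, heq]

/-! ### Adding points in general position -/

theorem volume_affineSpan_pair {a b : Plane} (hab : a ≠ b) :
    MeasureTheory.volume (affineSpan ℝ {a, b} : Set Plane) = 0 := by
  apply MeasureTheory.Measure.addHaar_affineSubspace
  intro h
  -- This point is a plus the quarter turn of b - a, which lies off the line.
  have hc : !₂[a 0 - (b 1 - a 1), a 1 + (b 0 - a 0)] ∈ affineSpan ℝ {a, b} := by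
    rw [h]; trivial
  have := collinear_insert_of_mem_affineSpan_pair hc
  rw [collinear_iff_signedArea_eq_zero] at this
  apply hab
  simp [signedArea] at this
  ext i; fin_cases i <;> simp <;> nlinarith [sq_nonneg (b 0 - a 0), sq_nonneg (b 1 - a 1)]

theorem InGeneralPosition.insert_of_signedArea {S : Finset Plane} (hS : InGeneralPosition S) {p : Plane}
    (hp : ∀ a ∈ S, ∀ b ∈ S, a ≠ b → signedArea p a b ≠ 0) : InGeneralPosition (insert p S) := by
  intro a ha b hb c hc hab hac hbc
  rw [collinear_iff_signedArea_eq_zero]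
  rcases Finset.mem_insert.1 ha with rfl | ha'
  · exact hp b ((Finset.mem_insert.1 hb).resolve_left hab.symm) c
      ((Finset.mem_insert.1 hc).resolve_left hac.symm) hbc
  rcases Finset.mem_insert.1 hb with rfl | hb'
  · intro h
    refine hp c ((Finset.mem_insert.1 hc).resolve_left hbc.symm) a ha' hac.symm ?_
    rw [← h]; unfold signedArea; ring
  rcases Finset.mem_insert.1 hc with rfl | hc'
  · intro h
    refine hp a ha' b hb' hab ?_
    rw [← h]; unfold signedArea; ring
  · exact hS.signedArea_ne_zero ha' hb' hc' hab hac hbc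

/-- The finitely many lines through pairs of points of S have measure zero, so they cannot cover a
nonempty open set. -/
theorem InGeneralPosition.exists_insert_mem {S : Finset Plane} (hS : InGeneralPosition S)
    {U : Set Plane} (hU : IsOpen U) (hne : U.Nonempty) :
    ∃ p ∈ U, InGeneralPosition (insert p S) := by
  have hnull : MeasureTheory.volume
      (⋃ e ∈ S.offDiag, (affineSpan ℝ {e.1, e.2} : Set Plane)) = 0 :=
    (MeasureTheory.measure_biUnion_null_iff S.offDiag.countable_toSet).2 fun e he =>
      volume_affineSpan_pair (Finset.mem_offDiag.1 he).2.2
  have hpos := (hU.measure_pos MeasureTheory.volume hne).ne'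
  have : ¬ U ⊆ ⋃ e ∈ S.offDiag, (affineSpan ℝ {e.1, e.2} : Set Plane) := fun h =>
    hpos (MeasureTheory.measure_mono_null h hnull)
  obtain ⟨p, hpU, hp⟩ := Set.not_subset.1 this
  refine ⟨p, hpU, hS.insert_of_signedArea fun a ha b hb hab h => hp ?_⟩
  have hcol := (collinear_iff_signedArea_eq_zero p a b).2 h
  refine Set.mem_biUnion (x := (a, b)) (Finset.mem_offDiag.2 ⟨ha, hb, hab⟩) ?_
  exact hcol.mem_affineSpan_of_mem_of_ne (by simp) (by simp) (by simp) hab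

theorem notMem_convexHull_of_forall_lt {S : Finset Plane} {p : Plane} (g : Plane →ₗ[ℝ] ℝ)
    (h : ∀ s ∈ S, g s < g p) : p ∉ convexHull ℝ (S : Set Plane) := fun hp =>
  lt_irrefl (g p) (convexHull_min h (convex_halfSpace_lt g.isLinear (g p)) hp)

/-- A point can be added in any open set beyond a supporting line, keeping general position. -/
theorem InGeneralPosition.exists_insert {S : Finset Plane} (hS : InGeneralPosition S)
    {U : Set Plane} (hU : IsOpen U) (hne : U.Nonempty) (g : Plane →ₗ[ℝ] ℝ)
    (h : ∀ p ∈ U, ∀ s ∈ S, g s < g p) :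
    ∃ p ∈ U, InGeneralPosition (insert p S) ∧ (insert p S).card = S.card + 1 ∧
      sc S ≤ sc (insert p S) := by
  obtain ⟨p, hpU, hgp⟩ := hS.exists_insert_mem hU hne
  have hp := notMem_convexHull_of_forall_lt g (h p hpU)
  exact ⟨p, hpU, hgp, Finset.card_insert_of_notMem (notMem_of_notMem_convexHull hp),
    sc_le_sc_insert hgp hp⟩

/-! ### Enclosing a point set in a triangle -/

theorem mem_convexHull_triple {a b c q : Plane} (hA : 0 < signedArea b c q)
    (hB : 0 < signedArea c a q) (hC : 0 < signedArea a b q) :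
    q ∈ convexHull ℝ ({a, b, c} : Set Plane) := by
  set A := signedArea b c q with hA'
  set B := signedArea c a q with hB'
  set C := signedArea a b q with hC'
  have hD : 0 < A + B + C := by linarith
  -- Barycentric coordinates as ratios of areas.
  have hq : q = ∑ i, (![A / (A + B + C), B / (A + B + C), C / (A + B + C)] i) • (![a, b, c] i) := by
    simp only [Fin.sum_univ_three]
    ext i; fin_cases i
    · simp; field_simp; rw [hA', hB', hC']; unfold signedArea; ring
    · simp; field_simp; rw [hA', hB', hC']; unfold signedArea; ring
  rw [hq]
  refine (convex_convexHull ℝ _).sum_mem ?_ ?_ ?_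
  · intro i _
    fin_cases i <;> simp <;> positivity
  · simp [Fin.sum_univ_three]; field_simp
  · intro i _
    apply subset_convexHull
    fin_cases i <;> simp

theorem hasTriangularHull_of_subset {S : Finset Plane} {a b c : Plane}
    (hnd : signedArea a b c ≠ 0) (ha : a ∈ S) (hb : b ∈ S) (hc : c ∈ S)
    (hS : (S : Set Plane) ⊆ convexHull ℝ ({a, b, c} : Set Plane)) : HasTriangularHull S := by
  have hnc : ¬ Collinear ℝ {a, b, c} := fun h => hnd ((collinear_iff_signedArea_eq_zero a b c).1 h)
  refine ⟨⟨![a, b, c], affineIndependent_iff_not_collinear_set.2 hnc⟩, ?_⟩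
  have hr : Set.range ![a, b, c] = {a, b, c} := by
    simp only [Matrix.range_cons, Matrix.range_empty, Set.union_empty, Set.singleton_union]
  change _ = convexHull ℝ (Set.range ![a, b, c])
  rw [hr]
  apply Set.Subset.antisymm
  · exact convexHull_min hS (convex_convexHull ℝ _)
  · apply convexHull_mono
    rintro x (rfl | rfl | rfl) <;> assumption

/-- The `i`-th coordinate. -/
noncomputable def coordFun (i : Fin 2) : Plane →ₗ[ℝ] ℝ := (EuclideanSpace.proj i : Plane →L[ℝ] ℝ)

theorem coordFun_apply (i : Fin 2) (x : Plane) : coordFun i x = x i := rfl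

theorem exists_coord_bound (S : Finset Plane) :
    ∃ R : ℝ, 0 < R ∧ ∀ s ∈ S, ∀ i, |s i| ≤ R := by
  obtain ⟨R, hR0, hR⟩ := S.finite_toSet.isBounded.exists_pos_norm_le
  exact ⟨R, hR0, fun s hs i => (PiLp.norm_apply_le s i).trans (hR s hs)⟩

/-- An open axis-parallel box. -/
def openBox (l r b t : ℝ) : Set Plane := {x | (l < x 0 ∧ x 0 < r) ∧ b < x 1 ∧ x 1 < t}

theorem isOpen_openBox (l r b t : ℝ) : IsOpen (openBox l r b t) := by
  have h0 : Continuous fun x : Plane => x 0 := by fun_prop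
  have h1 : Continuous fun x : Plane => x 1 := by fun_prop
  exact ((isOpen_lt continuous_const h0).inter (isOpen_lt h0 continuous_const)).inter
    ((isOpen_lt continuous_const h1).inter (isOpen_lt h1 continuous_const))

theorem openBox_nonempty {l r b t : ℝ} (hlr : l < r) (hbt : b < t) : (openBox l r b t).Nonempty :=
  ⟨!₂[(l + r) / 2, (b + t) / 2], by
    simp only [openBox, Set.mem_ofPred_eq]
    refine ⟨⟨?_, ?_⟩, ?_, ?_⟩ <;> simp <;> linarith⟩

/-- The boxes are far enough out that every choice of corners gives a counterclockwise triangle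
around the square [-R, R]². They also lie successively to the left, to the right and above all that
precedes, so each corner is added outside the current hull. -/
theorem signedArea_pos_of_mem_openBox {R : ℝ} (hR : 0 < R) {a b c q : Plane}
    (ha : a ∈ openBox (-(11 * R)) (-(10 * R)) (-(5 * R)) (-(4 * R)))
    (hb : b ∈ openBox (10 * R) (11 * R) (-(5 * R)) (-(4 * R)))
    (hc : c ∈ openBox (-R) R (20 * R) (21 * R)) (hq : ∀ i, |q i| ≤ R) :
    0 < signedArea b c q ∧ 0 < signedArea c a q ∧ 0 < signedArea a b q := by
  obtain ⟨⟨a1, a2⟩, a3, a4⟩ := ha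
  obtain ⟨⟨b1, b2⟩, b3, b4⟩ := hb
  obtain ⟨⟨c1, c2⟩, c3, c4⟩ := hc
  obtain ⟨q1, q2⟩ := abs_le.1 (hq 0)
  obtain ⟨q3, q4⟩ := abs_le.1 (hq 1)
  have hR2 : 0 < R * R := mul_pos hR hR
  unfold signedArea
  refine ⟨?_, ?_, ?_⟩
  · have h1 : (b 0 - c 0) * (q 1 - b 1) ≤ (12 * R) * (6 * R) :=
      mul_le_mul (by linarith) (by linarith) (by linarith) (by linarith)
    have h2 : (24 * R) * (9 * R) ≤ (c 1 - b 1) * (b 0 - q 0) :=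
      mul_le_mul (by linarith) (by linarith) (by linarith) (by linarith)
    nlinarith
  · have h1 : (9 * R) * (19 * R) ≤ (c 0 - a 0) * (c 1 - q 1) :=
      mul_le_mul (by linarith) (by linarith) (by linarith) (by linarith)
    have h2 : (c 1 - a 1) * (c 0 - q 0) ≤ (26 * R) * (2 * R) :=
      mul_le_mul_of_nonneg (by linarith) (by linarith) (by linarith) (by linarith)
    nlinarith
  · have h1 : (20 * R) * (3 * R) ≤ (b 0 - a 0) * (q 1 - a 1) :=
      mul_le_mul (by linarith) (by linarith) (by linarith) (by linarith)
    have h2 : (b 1 - a 1) * (q 0 - a 0) ≤ R * (12 * R) :=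
      mul_le_mul (by linarith) (by linarith) (by linarith) (by linarith)
    nlinarith

theorem InGeneralPosition.exists_triangularHull {S : Finset Plane} (hS : InGeneralPosition S) :
    ∃ T : Finset Plane, InGeneralPosition T ∧ HasTriangularHull T ∧ T.card = S.card + 3 ∧
      sc S ≤ sc T := by
  obtain ⟨R, hR, hSR⟩ := exists_coord_bound S
  have hSR' : ∀ s ∈ S, ∀ i, -R ≤ s i ∧ s i ≤ R := fun s hs i => abs_le.1 (hSR s hs i)
  obtain ⟨a, ha, hgpa, hca, hsa⟩ := hS.exists_insert
    (isOpen_openBox (-(11 * R)) (-(10 * R)) (-(5 * R)) (-(4 * R)))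
    (openBox_nonempty (by linarith) (by linarith)) (-coordFun 0) (by
      rintro p ⟨⟨h1, h2⟩, -⟩ s hs
      have := hSR' s hs 0
      simp only [LinearMap.neg_apply, coordFun_apply]
      linarith)
  obtain ⟨b, hb, hgpb, hcb, hsb⟩ := hgpa.exists_insert
    (isOpen_openBox (10 * R) (11 * R) (-(5 * R)) (-(4 * R)))
    (openBox_nonempty (by linarith) (by linarith)) (coordFun 0) (by
      rintro p ⟨⟨h1, h2⟩, -⟩ s hs
      simp only [coordFun_apply]
      rcases Finset.mem_insert.1 hs with rfl | hs
      · linarith [ha.1.2]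
      · linarith [hSR' s hs 0])
  obtain ⟨c, hc, hgpc, hcc, hsc⟩ := hgpb.exists_insert
    (isOpen_openBox (-R) R (20 * R) (21 * R))
    (openBox_nonempty (by linarith) (by linarith)) (coordFun 1) (by
      rintro p ⟨-, h1, h2⟩ s hs
      simp only [coordFun_apply]
      rcases Finset.mem_insert.1 hs with rfl | hs
      · linarith [hb.2.2]
      rcases Finset.mem_insert.1 hs with rfl | hs
      · linarith [ha.2.2]
      · linarith [hSR' s hs 1])
  refine ⟨_, hgpc, ?_, by omega, hsa.trans (hsb.trans hsc)⟩
  have hab : a ≠ b := by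
    rintro rfl
    linarith [ha.1.2, hb.1.1]
  have hac : a ≠ c := by
    rintro rfl
    linarith [ha.2.2, hc.2.1]
  have hbc : b ≠ c := by
    rintro rfl
    linarith [hb.2.2, hc.2.1]
  refine hasTriangularHull_of_subset (a := a) (b := b) (c := c)
    (hgpc.signedArea_ne_zero (by simp) (by simp) (by simp) hab hac hbc)
    (by simp) (by simp) (by simp) ?_
  intro q hq
  rcases Finset.mem_insert.1 hq with rfl | hq
  · exact subset_convexHull ℝ _ (by simp)
  rcases Finset.mem_insert.1 hq with rfl | hq
  · exact subset_convexHull ℝ _ (by simp)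
  rcases Finset.mem_insert.1 hq with rfl | hq
  · exact subset_convexHull ℝ _ (by simp)
  obtain ⟨h1, h2, h3⟩ := signedArea_pos_of_mem_openBox hR ha hb hc (hSR q hq)
  exact mem_convexHull_triple h1 h2 h3

theorem InGeneralPosition.exists_even_triangularHull {S : Finset Plane}
    (hS : InGeneralPosition S) :
    ∃ T : Finset Plane, InGeneralPosition T ∧ Even T.card ∧ HasTriangularHull T ∧
      T.card ≤ S.card + 4 ∧ sc S ≤ sc T := by
  rcases Nat.even_or_odd S.card with he | ho
  -- The three corners flip the parity, so an even set first receives one extra point to its right.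
  · obtain ⟨R, hR, hSR⟩ := exists_coord_bound S
    obtain ⟨p, -, hgp, hcard, hsc⟩ := hS.exists_insert (isOpen_openBox R (R + 1) 0 1)
      (openBox_nonempty (by linarith) (by linarith)) (coordFun 0) (by
        rintro p ⟨⟨h1, -⟩, -⟩ s hs
        simp only [coordFun_apply]
        linarith [(abs_le.1 (hSR s hs 0)).2])
    obtain ⟨T, hT, hTri, hTcard, hTsc⟩ := hgp.exists_triangularHull
    refine ⟨T, hT, ?_, hTri, by omega, hsc.trans hTsc⟩
    obtain ⟨k, hk⟩ := he
    exact ⟨k + 2, by omega⟩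
  · obtain ⟨T, hT, hTri, hTcard, hTsc⟩ := hS.exists_triangularHull
    refine ⟨T, hT, ?_, hTri, by omega, hTsc⟩
    rw [hTcard]
    exact ho.add_odd ⟨1, rfl⟩

theorem mainTheorem9 :
    (∀ (S : Finset Plane) (p : Plane), InGeneralPosition (insert p S) →
      p ∉ convexHull ℝ (S : Set Plane) → sc S ≤ sc (insert p S)) ∧
    (∀ c : ℝ, 1 < c →
      ScBigO {S | InGeneralPosition S ∧ Even S.card ∧ HasTriangularHull S} c →
      ScBigO {S | InGeneralPosition S} c) := by
  refine ⟨fun S p hS hp => sc_le_sc_insert hS hp, fun c hc h => ?_⟩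
  have hc0 : 0 < c := by linarith
  rw [scBigO_iff _ hc0] at h ⊢
  obtain ⟨K, hK⟩ := h
  -- The factor c ^ 4 pays for the at most four added points; the absolute value makes the constant
  -- nonnegative, so that the exponent may be raised.
  refine ⟨|K| * c ^ 4, fun S hS => ?_⟩
  obtain ⟨T, hT, hEven, hTri, hcard, hsc⟩ := InGeneralPosition.exists_even_triangularHull hS
  calc (sc S : ℝ) ≤ sc T := by exact_mod_cast hsc
    _ ≤ K * c ^ T.card := hK T ⟨hT, hEven, hTri⟩
    _ ≤ |K| * c ^ (S.card + 4) := mul_le_mul (le_abs_self K)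
        (pow_le_pow_right₀ hc.le hcard) (by positivity) (abs_nonneg K)
    _ = |K| * c ^ 4 * c ^ S.card := by ring
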